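/- **Theorem 2.** Let $n\ge 3$ and let $C\in\mathbb{R}^{n\times n}$ be row-stochastic (nonnegative entries, row sums $1$), irreducible and with zero diagonal. Let $G(C)$ be the digraph on $\{1,\dots,n\}$ with an edge $(i,j)$ whenever $C_{ij}\neq 0$, and assume that $G(C)$ does not have star topology, i.e. there is no node $m$ such that every edge of $G(C)$ is from or to $m$. Let $c$ be the dominant left eigenvector of $C$, i.e. the vector with nonnegative entries, $\sum_i c_i=1$ and $c^\top C=c^\top$. Let $\Delta_n=\{x\in\mathbb{R}^n : x_i\ge 0,\ \sum_i x_i=1\}$, with vertices $e_1,\dots,e_n$ (the standard basis vectors), let $W(x)=\operatorname{diag}(x)+(I-\operatorname{diag}(x))C$, and let $$F(x)=W(x)^\top x=C^\top x+(I-C^\top)x^2,\qquad x^2:=(x_1^2,\dots,x_n^2).$$ Then there is a point $x^*$ in the (relative) interior of $\Delta_n$ such that: (i) the set of fixed points of $F$ in $\Delta_n$ is $\{e_1,\dots,e_n,x^*\}$, and the entries of $x^*$ are ordered as those of $c$: for all $i,j$, $x^*_i<x^*_j$ if and only if $c_i<c_j$; (ii) for every initial condition $x(0)\in\Delta_n\setminus\{e_1,\dots,e_n\}$,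 the solution of $x(t+1)=W(x(t))^\top x(t)$, $t=0,1,2,\dots$, converges exponentially to $x^*$: there is a rate $\rho\in(0,1)$, depending only on $C$, such that for every such $x(0)$ there is a constant $K>0$ with $\|x(t)-x^*\|\le K\rho^t$ for all $t\ge 0$. -/

import Mathlib

open scoped Matrix

namespace SingleTimescaleDF

/-- The digraph `G(C)` of a matrix `C`: there is an edge from `i` to `j` iff `C i j ≠ 0`. -/
def digraph {n : ℕ} (C : Matrix (Fin n) (Fin n) ℝ) : Digraph (Fin n) :=
  ⟨fun i j => C i j ≠ 0⟩

/-- A digraph has star topology if there is a center node such that every edge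
is either from or to the center. -/
def HasStarTopology {n : ℕ} (G : Digraph (Fin n)) : Prop :=
  ∃ m, ∀ i j, G.Adj i j → i = m ∨ j = m

/-- `c` is the dominant left eigenvector of the row-stochastic matrix `C`: the left eigenvector
for the eigenvalue `1` with nonnegative entries, normalized to have sum `1`. -/
def IsDominantLeftEigenvector {n : ℕ} (C : Matrix (Fin n) (Fin n) ℝ) (c : Fin n → ℝ) : Prop :=
  c ∈ stdSimplex ℝ (Fin n) ∧ c ᵥ* C = c

/-- The influence matrix `W(x) = diag(x) + (I - diag(x)) C`. -/
def W {n : ℕ} (C : Matrix (Fin n) (Fin n) ℝ) (x : Fin n → ℝ) : Matrix (Fin n) (Fin n) ℝ :=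
  Matrix.diagonal x + (1 - Matrix.diagonal x) * C

/-- The map `F(x) = Cᵀ x + (I - Cᵀ) x²`, where `x²` is the entrywise square. -/
def F {n : ℕ} (C : Matrix (Fin n) (Fin n) ℝ) (x : Fin n → ℝ) : Fin n → ℝ :=
  Cᵀ *ᵥ x + (1 - Cᵀ) *ᵥ (x ^ 2)

/-- The two forms of the single-timescale DeGroot–Friedkin dynamics agree. -/
theorem W_transpose_mulVec_eq_F {n : ℕ} (C : Matrix (Fin n) (Fin n) ℝ) (x : Fin n → ℝ) :
    (W C x)ᵀ *ᵥ x = F C x := by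
  have h : Matrix.diagonal x *ᵥ x = x ^ 2 := by
    ext i
    simp [Matrix.mulVec_diagonal, pow_two]
  simp only [W, F, Matrix.transpose_add, Matrix.transpose_mul, Matrix.transpose_sub,
    Matrix.transpose_one, Matrix.diagonal_transpose, Matrix.add_mulVec, Matrix.sub_mulVec,
    ← Matrix.mulVec_mulVec, Matrix.mulVec_sub, Matrix.one_mulVec, h]
  abel

/-- The set of the vertices `e_1, …, e_n` of the simplex (the autocratic configurations). -/
def vertices (n : ℕ) : Set (Fin n → ℝ) :=
  Set.range fun i : Fin n => (Pi.single i 1 : Fin n → ℝ)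

/-- `x` is a trajectory of the system `x(t+1) = W(x(t))ᵀ x(t)`. -/
def IsTrajectory {n : ℕ} (C : Matrix (Fin n) (Fin n) ℝ) (x : ℕ → Fin n → ℝ) : Prop :=
  ∀ t, x (t + 1) = (W C (x t))ᵀ *ᵥ x t

end SingleTimescaleDF

namespace SingleTimescaleDF

/-! Put `u i = x i * (1 - x i) / c i`. This is the gradient of `energy c`, and `F C x - x` is the
inflow of `c * u` along `C` minus `c * u`. Since `C` has stationary vector `c`, pairing the
displacement with `u` gives minus half a Dirichlet sum over edges, so the step is a descent
direction. The energy is cubic, hence its Taylor expansion is exact, and Cauchy–Schwarz absorbs the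
second-order term: `sum_le_energy_sub` bounds the decrease below by a weighted sum of squared
displacements. The energy is thus a strict Lyapunov function off the fixed points.

The vertices are fixed as well and must be excluded as limits. Because no node is the center of a
star, a weighted distance to each vertex grows near it (`vertexDist_le_vertexDist_F`), so a
trajectory starting off the vertices stays in a compact set avoiding them. There the energy argument
gives existence of another fixed point and, once that point is unique, convergence to it.

At a nonvertex fixed point `u` is a positive constant, i.e. `x i * (1 - x i) = α * c i`. This yields
positivity, the ordering, and, by comparing extreme ratios of two solutions, uniqueness
(`eq_of_eq_mul`).

For the rate, the Hessian of the energy is positive definite on sum-zero vectors (`hessian_pos`).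
Near the fixed point, excess energy and one-step decrease are then both of the order of the squared
distance, so the excess contracts geometrically. -/

variable {n : ℕ} {C : Matrix (Fin n) (Fin n) ℝ} {c x y z : Fin n → ℝ}

/-! ### Irreducibility, the star condition and invariance of the simplex -/

/-- A nonempty set of nodes that is closed under the edges of an irreducible matrix contains
every node. -/
theorem forall_of_closed (hC : C.IsIrreducible) {p : Fin n → Prop} {i : Fin n} (hi : p i)
    (h : ∀ i j, p i → 0 < C i j → p j) (j : Fin n) : p j := by
  let := C.toQuiver
  obtain ⟨q, -⟩ := hC.connected i j
  induction q with
  | nil => exact hi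
  | cons q e ih => exact h _ _ ih e.down

theorem eigenvector_pos (hC : C.IsIrreducible) (hc : c ∈ stdSimplex ℝ (Fin n))
    (hcC : ∀ i, ∑ j, c j * C j i = c i) (i : Fin n) : 0 < c i := by
  obtain ⟨k, hk⟩ : ∃ k, 0 < c k := by
    by_contra! h
    have h1 : ∑ i, c i ≤ 0 := Finset.sum_nonpos fun i _ => h i
    linarith [hc.2]
  refine forall_of_closed hC (p := fun i => 0 < c i) hk (fun i j hi hij => ?_) i
  rw [← hcC j]
  exact (mul_pos hi hij).trans_le
    (Finset.single_le_sum (f := fun k => c k * C k j)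
      (fun k _ => mul_nonneg (hc.1 k) (hC.nonneg k j)) (Finset.mem_univ i))

/-- The probability of not returning in two steps to a node is positive unless the node is the
center of a star. -/
theorem sum_mul_one_sub_pos (hCs : C ∈ Matrix.rowStochastic ℝ (Fin n)) (hC : C.IsIrreducible)
    (hstar : ¬ HasStarTopology (digraph C)) (m : Fin n) :
    0 < ∑ i, C m i * (1 - C i m) := by
  have hnn : ∀ i ∈ Finset.univ, 0 ≤ C m i * (1 - C i m) := fun i _ =>
    mul_nonneg (hC.nonneg m i)
      (sub_nonneg.2 (Matrix.le_one_of_mem_rowStochastic hCs))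
  refine (Finset.sum_nonneg hnn).lt_of_ne fun h0 => hstar ⟨m, ?_⟩
  rw [eq_comm, Finset.sum_eq_zero_iff_of_nonneg hnn] at h0
  have only : ∀ i j, C i m = 1 → C i j ≠ 0 → j = m := by
    intro i j h1 hij
    by_contra hjm
    have h2 : C i m + C i j ≤ ∑ k, C i k := by
      rw [← Finset.sum_pair (Ne.symm hjm) (f := fun k => C i k)]
      exact Finset.sum_le_sum_of_subset_of_nonneg (Finset.subset_univ _)
        fun k _ _ => hC.nonneg i k
    rw [Matrix.sum_row_of_mem_rowStochastic hCs, h1] at h2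
    exact hij (le_antisymm (by linarith) (hC.nonneg i j))
  -- A vanishing sum means that every out-neighbour of `m` sends all its weight back to `m`;
  -- irreducibility then leaves no other nodes.
  have key : ∀ i, i = m ∨ C i m = 1 := by
    refine forall_of_closed hC (i := m) (Or.inl rfl) ?_
    rintro i j (rfl | h) hij
    · rcases mul_eq_zero.1 (h0 j (Finset.mem_univ j)) with h | h
      · exact absurd h hij.ne'
      · right; linarith
    · exact Or.inl (only i j h hij.ne')
  intro i j hij
  rcases key i with h | h
  · exact Or.inl h
  · exact Or.inr (only i j h hij)

/-- Flux form: node `j` emits `x j * (1 - x j)` and distributes it along row `j` of `C`. -/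
theorem F_apply (C : Matrix (Fin n) (Fin n) ℝ) (x : Fin n → ℝ) (i : Fin n) :
    F C x i = x i - x i * (1 - x i) + ∑ j, C j i * (x j * (1 - x j)) := by
  have h : ∑ j, C j i * (x j * (1 - x j)) = ∑ j, C j i * x j - ∑ j, C j i * x j ^ 2 := by
    rw [← Finset.sum_sub_distrib]
    exact Finset.sum_congr rfl fun j _ => by ring
  rw [h]
  simp only [F, Matrix.sub_mulVec, Matrix.one_mulVec, Pi.add_apply, Pi.sub_apply, Matrix.mulVec,
    dotProduct, Matrix.transpose_apply, Pi.pow_apply]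
  ring

/-- Mass balance: summing a weight against the inflow `Cᵀ y`. -/
theorem sum_mul_inflow (w y : Fin n → ℝ) :
    ∑ i, w i * ∑ j, C j i * y j = ∑ j, y j * ∑ i, C j i * w i := by
  simp only [Finset.mul_sum]
  rw [Finset.sum_comm]
  exact Finset.sum_congr rfl fun j _ => Finset.sum_congr rfl fun i _ => by ring

theorem mul_one_sub_nonneg (hx : x ∈ stdSimplex ℝ (Fin n)) (i : Fin n) :
    0 ≤ x i * (1 - x i) :=
  mul_nonneg (hx.1 i) (sub_nonneg.2 (by
    rw [← hx.2]
    exact Finset.single_le_sum (fun j _ => hx.1 j) (Finset.mem_univ i)))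

theorem le_one_of_mem_stdSimplex (hx : x ∈ stdSimplex ℝ (Fin n)) (i : Fin n) : x i ≤ 1 := by
  rw [← hx.2]
  exact Finset.single_le_sum (fun j _ => hx.1 j) (Finset.mem_univ i)

theorem F_mem_stdSimplex (hCs : C ∈ Matrix.rowStochastic ℝ (Fin n))
    (hx : x ∈ stdSimplex ℝ (Fin n)) : F C x ∈ stdSimplex ℝ (Fin n) := by
  refine ⟨fun i => ?_, ?_⟩
  · rw [F_apply]
    have h : 0 ≤ ∑ j, C j i * (x j * (1 - x j)) := Finset.sum_nonneg fun j _ =>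
      mul_nonneg (Matrix.nonneg_of_mem_rowStochastic hCs) (mul_one_sub_nonneg hx j)
    nlinarith [sq_nonneg (x i)]
  · have h := sum_mul_inflow (C := C) (fun _ => 1) (fun j => x j * (1 - x j))
    simp only [one_mul, mul_one, Matrix.sum_row_of_mem_rowStochastic hCs] at h
    simp only [F_apply, Finset.sum_add_distrib, Finset.sum_sub_distrib, h, hx.2]
    ring

theorem mem_vertices_of_apply_eq_one (hx : x ∈ stdSimplex ℝ (Fin n)) {m : Fin n}
    (hm : x m = 1) : x ∈ vertices n := by
  refine ⟨m, funext fun i => ?_⟩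
  have h0 : ∑ j ∈ Finset.univ.erase m, x j = 0 := by
    have := Finset.add_sum_erase Finset.univ x (Finset.mem_univ m)
    rw [hx.2, hm] at this
    linarith
  rcases eq_or_ne i m with rfl | hi
  · simp [hm]
  · rw [Finset.sum_eq_zero_iff_of_nonneg fun j _ => hx.1 j] at h0
    simp [hi, h0 i (by simp [hi])]

theorem apply_lt_one (hx : x ∈ stdSimplex ℝ (Fin n) \ vertices n) (m : Fin n) : x m < 1 :=
  (le_one_of_mem_stdSimplex hx.1 m).lt_of_ne fun h =>
    hx.2 (mem_vertices_of_apply_eq_one hx.1 h)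

/-! ### Dissipation -/

/-- Expand the square: both diagonal parts equal `∑ c i * u i ^ 2`, one by stationarity of `c` and
the other by the unit row sums. No reversibility is needed. -/
theorem sum_mul_displacement_eq (hCs : C ∈ Matrix.rowStochastic ℝ (Fin n))
    (hcC : ∀ i, ∑ j, c j * C j i = c i) (u : Fin n → ℝ) :
    ∑ i, u i * (∑ j, C j i * (c j * u j) - c i * u i) =
      -(1 / 2) * ∑ i, ∑ j, c j * C j i * (u i - u j) ^ 2 := by
  have h1 : ∑ i, ∑ j, c j * C j i * u i ^ 2 = ∑ i, c i * u i ^ 2 :=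
    Finset.sum_congr rfl fun i _ => by rw [← Finset.sum_mul, hcC]
  have h2 : ∑ i, ∑ j, c j * C j i * u j ^ 2 = ∑ i, c i * u i ^ 2 := by
    rw [Finset.sum_comm]
    refine Finset.sum_congr rfl fun j _ => ?_
    rw [← Finset.sum_mul, ← Finset.mul_sum, Matrix.sum_row_of_mem_rowStochastic hCs, mul_one]
  have h3 : ∑ i, ∑ j, c j * C j i * (u i - u j) ^ 2 =
      ∑ i, ∑ j, c j * C j i * u i ^ 2 + ∑ i, ∑ j, c j * C j i * u j ^ 2
        - 2 * ∑ i, u i * ∑ j, C j i * (c j * u j) := by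
    simp only [Finset.mul_sum, ← Finset.sum_add_distrib, ← Finset.sum_sub_distrib]
    exact Finset.sum_congr rfl fun i _ => Finset.sum_congr rfl fun j _ => by ring
  have h4 : ∑ i, u i * (c i * u i) = ∑ i, c i * u i ^ 2 :=
    Finset.sum_congr rfl fun i _ => by ring
  simp only [mul_sub, Finset.sum_sub_distrib, h4]
  rw [h3, h1, h2]
  ring

/-- Stationarity makes the displacement at `i` a sum of the differences `u j - u i` with weights `c
j * C j i` of total `c i`; this is Cauchy–Schwarz for those weights. -/
theorem displacement_sq_le (hC : C.IsIrreducible) (hc : ∀ i, 0 < c i)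
    (hcC : ∀ i, ∑ j, c j * C j i = c i) (u : Fin n → ℝ) (i : Fin n) :
    (∑ j, C j i * (c j * u j) - c i * u i) ^ 2 / c i ≤
      ∑ j, c j * C j i * (u i - u j) ^ 2 := by
  have hw : ∀ j, 0 ≤ c j * C j i := fun j => mul_nonneg (hc j).le (hC.nonneg j i)
  have h1 : ∑ j, C j i * (c j * u j) - c i * u i = ∑ j, c j * C j i * (u j - u i) := by
    simp only [mul_sub, Finset.sum_sub_distrib, ← Finset.sum_mul, hcC]
    congr 1
    exact Finset.sum_congr rfl fun j _ => by ring
  rw [h1, div_le_iff₀ (hc i), mul_comm]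
  refine (Finset.sum_sq_le_sum_mul_sum_of_sq_le_mul _ (fun j _ => hw j)
    (fun j _ => mul_nonneg (hw j) (sq_nonneg (u i - u j))) fun j _ => by
      exact le_of_eq (by ring)).trans_eq ?_
  rw [hcC]

/-- The left eigenvectors of `C` for the eigenvalue `1` are the multiples of `c`. -/
theorem exists_eq_mul_of_inflow_eq (hCs : C ∈ Matrix.rowStochastic ℝ (Fin n))
    (hC : C.IsIrreducible) (hc : ∀ i, 0 < c i) (hcC : ∀ i, ∑ j, c j * C j i = c i)
    (hy : ∀ i, ∑ j, C j i * y j = y i) : ∃ α, ∀ i, y i = α * c i := by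
  rcases isEmpty_or_nonempty (Fin n) with _ | ⟨⟨k⟩⟩
  · exact ⟨0, fun i => isEmptyElim i⟩
  have hu : ∀ i, c i * (y i / c i) = y i := fun i => mul_div_cancel₀ _ (hc i).ne'
  have h := sum_mul_displacement_eq hCs hcC (fun i => y i / c i)
  simp only [hu, hy, sub_self, mul_zero, Finset.sum_const_zero] at h
  have hnn : ∀ i j, 0 ≤ c j * C j i * (y i / c i - y j / c j) ^ 2 := fun i j =>
    mul_nonneg (mul_nonneg (hc j).le (hC.nonneg j i)) (sq_nonneg _)
  -- The Dirichlet sum vanishes, so `y / c` agrees at the two ends of each edge and hence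
  -- everywhere.
  have h0 : ∑ i, ∑ j, c j * C j i * (y i / c i - y j / c j) ^ 2 = 0 := by linarith
  rw [Finset.sum_eq_zero_iff_of_nonneg fun i _ => Finset.sum_nonneg fun j _ => hnn i j] at h0
  refine ⟨y k / c k, fun i => ?_⟩
  have key : y i / c i = y k / c k := by
    refine forall_of_closed hC (p := fun i => y i / c i = y k / c k) (i := k) rfl
      (fun j i hj hji => ?_) i
    have h1 := (Finset.sum_eq_zero_iff_of_nonneg fun j _ => hnn i j).1
      (h0 i (Finset.mem_univ i)) j (Finset.mem_univ j)
    have h2 := (mul_eq_zero.1 h1).resolve_left (mul_pos (hc j) hji).ne'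
    rw [← hj]
    linarith [pow_eq_zero_iff two_ne_zero |>.1 h2]
  rw [← key, div_mul_cancel₀ _ (hc i).ne']

/-- The Lyapunov function of the dynamics. -/
noncomputable def energy (c x : Fin n → ℝ) : ℝ :=
  ∑ i, (x i ^ 2 / 2 - x i ^ 3 / 3) / c i

theorem continuous_energy (c : Fin n → ℝ) : Continuous (energy c) := by
  unfold energy
  fun_prop

theorem continuous_F (C : Matrix (Fin n) (Fin n) ℝ) : Continuous (F C) := by
  refine continuous_pi fun i => ?_
  simp only [F_apply]
  fun_prop

/-- Exact Taylor expansion of the cubic energy. The first-order gain is half the Dirichlet sum,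
which pays for the loss `1 / 2 * ∑ d i ^ 2 / c i`, where `d` is the displacement; the part that
comes from `-x ^ 3 / 3` remains. -/
theorem sum_le_energy_sub (hCs : C ∈ Matrix.rowStochastic ℝ (Fin n))
    (hC : C.IsIrreducible) (hc : ∀ i, 0 < c i) (hcC : ∀ i, ∑ j, c j * C j i = c i)
    (x : Fin n → ℝ) :
    ∑ i, (2 * x i + F C x i) / (3 * c i) * (F C x i - x i) ^ 2 ≤
      energy c x - energy c (F C x) := by
  set u : Fin n → ℝ := fun i => x i * (1 - x i) / c i with hu
  have hcu : ∀ i, c i * u i = x i * (1 - x i) := fun i => mul_div_cancel₀ _ (hc i).ne'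
  have hd : ∀ i, F C x i - x i = ∑ j, C j i * (c j * u j) - c i * u i := fun i => by
    simp only [hcu, F_apply]; ring
  have h1 := sum_mul_displacement_eq hCs hcC u
  have h2 := Finset.sum_le_sum fun i (_ : i ∈ Finset.univ) => displacement_sq_le hC hc hcC u i
  simp only [← hd] at h1 h2
  have h3 : energy c x - energy c (F C x) =
      ∑ i, (2 * x i + F C x i) / (3 * c i) * (F C x i - x i) ^ 2
        - ∑ i, u i * (F C x i - x i) - 1 / 2 * ∑ i, (F C x i - x i) ^ 2 / c i := by
    simp only [energy, Finset.mul_sum, ← Finset.sum_sub_distrib]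
    refine Finset.sum_congr rfl fun i _ => ?_
    have := (hc i).ne'
    simp only [hu]
    field_simp
    ring
  rw [h3]
  linarith

theorem energy_F_le (hCs : C ∈ Matrix.rowStochastic ℝ (Fin n))
    (hC : C.IsIrreducible) (hc : ∀ i, 0 < c i) (hcC : ∀ i, ∑ j, c j * C j i = c i)
    (hx : x ∈ stdSimplex ℝ (Fin n)) : energy c (F C x) ≤ energy c x := by
  refine sub_nonneg.1 (le_trans (Finset.sum_nonneg fun i _ => ?_)
    (sum_le_energy_sub hCs hC hc hcC x))
  have h1 := hx.1 i
  have h2 := (F_mem_stdSimplex hCs hx).1 i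
  have h3 := hc i
  positivity

theorem F_eq_self_of_energy_eq (hCs : C ∈ Matrix.rowStochastic ℝ (Fin n))
    (hC : C.IsIrreducible) (hc : ∀ i, 0 < c i) (hcC : ∀ i, ∑ j, c j * C j i = c i)
    (hx : x ∈ stdSimplex ℝ (Fin n)) (h : energy c (F C x) = energy c x) : F C x = x := by
  have hF := (F_mem_stdSimplex hCs hx).1
  have hnn : ∀ i ∈ Finset.univ,
      0 ≤ (2 * x i + F C x i) / (3 * c i) * (F C x i - x i) ^ 2 := fun i _ => by
    have h1 := hx.1 i
    have h2 := hF i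
    have h3 := hc i
    positivity
  have h0 := le_antisymm ((sum_le_energy_sub hCs hC hc hcC x).trans_eq (by rw [h, sub_self]))
    (Finset.sum_nonneg hnn)
  rw [Finset.sum_eq_zero_iff_of_nonneg hnn] at h0
  funext i
  have h1 := hx.1 i
  have h2 := hF i
  rcases mul_eq_zero.1 (h0 i (Finset.mem_univ i)) with h3 | h3
  -- A vanishing coefficient forces both `x i` and `F C x i` to be zero, as they are nonnegative.
  · rcases div_eq_zero_iff.1 h3 with h4 | h4
    · linarith
    · linarith [hc i]
  · linarith [pow_eq_zero_iff two_ne_zero |>.1 h3]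

/-! ### The vertices are repelling -/

/-- A weighted distance from the vertex `m` that grows along trajectories near this vertex. -/
noncomputable def vertexDist (C : Matrix (Fin n) (Fin n) ℝ) (m : Fin n) (x : Fin n → ℝ) : ℝ :=
  ∑ i, (if i = m then 0 else 2 - C i m) * x i

theorem sum_erase_eq (hx : x ∈ stdSimplex ℝ (Fin n)) (m : Fin n) :
    ∑ i ∈ Finset.univ.erase m, x i = 1 - x m := by
  have := Finset.add_sum_erase Finset.univ x (Finset.mem_univ m)
  rw [hx.2] at this
  linarith

theorem vertexDist_eq (C : Matrix (Fin n) (Fin n) ℝ) (m : Fin n) (x : Fin n → ℝ) :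
    vertexDist C m x = ∑ i ∈ Finset.univ.erase m, (2 - C i m) * x i := by
  rw [vertexDist, ← Finset.add_sum_erase _ _ (Finset.mem_univ m)]
  simp only [if_true, zero_mul, zero_add]
  exact Finset.sum_congr rfl fun i hi => by rw [if_neg (Finset.ne_of_mem_erase hi)]

theorem le_vertexDist (hCs : C ∈ Matrix.rowStochastic ℝ (Fin n))
    (hx : x ∈ stdSimplex ℝ (Fin n)) (m : Fin n) : 1 - x m ≤ vertexDist C m x := by
  rw [vertexDist_eq, ← sum_erase_eq hx m]
  refine Finset.sum_le_sum fun i _ => ?_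
  nlinarith [hx.1 i, Matrix.le_one_of_mem_rowStochastic hCs (i := i) (j := m)]

theorem vertexDist_le (hCs : C ∈ Matrix.rowStochastic ℝ (Fin n))
    (hx : x ∈ stdSimplex ℝ (Fin n)) (m : Fin n) : vertexDist C m x ≤ 2 * (1 - x m) := by
  rw [vertexDist_eq, ← sum_erase_eq hx m, Finset.mul_sum]
  refine Finset.sum_le_sum fun i _ => ?_
  nlinarith [hx.1 i, Matrix.nonneg_of_mem_rowStochastic hCs (i := i) (j := m)]

/-- Per unit of emitted flux, node `m` raises the weighted distance by `1 + b`, with `b` the sum in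
`hm`, and any other node lowers it by at most `1`. The change is at least `(1 - x m) * ((1 + b) * x
m - 1)`, and `hm` says that the second factor is nonnegative. -/
theorem vertexDist_le_vertexDist_F (hCs : C ∈ Matrix.rowStochastic ℝ (Fin n))
    (hdiag : ∀ i, C i i = 0) (hx : x ∈ stdSimplex ℝ (Fin n)) (m : Fin n)
    (hm : (1 + ∑ i, C m i * (1 - C i m)) * (1 - x m) ≤ ∑ i, C m i * (1 - C i m)) :
    vertexDist C m x ≤ vertexDist C m (F C x) := by
  set b := ∑ i, C m i * (1 - C i m) with hb
  set w : Fin n → ℝ := fun i => if i = m then 0 else 2 - C i m with hw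
  have hCnn : ∀ i j, 0 ≤ C i j := fun i j => Matrix.nonneg_of_mem_rowStochastic hCs
  have hCle : ∀ i j, C i j ≤ 1 := fun i j => Matrix.le_one_of_mem_rowStochastic hCs
  have hF : vertexDist C m (F C x) = vertexDist C m x +
      ∑ j, x j * (1 - x j) * (∑ i, C j i * w i - w j) := by
    have h := sum_mul_inflow (C := C) w (fun j => x j * (1 - x j))
    have hd : ∀ y, vertexDist C m y = ∑ i, y i * w i := fun y =>
      Finset.sum_congr rfl fun i _ => mul_comm _ _
    rw [hd, hd]
    simp only [mul_sub (_ * _), Finset.sum_sub_distrib]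
    rw [← h, ← Finset.sum_sub_distrib, ← Finset.sum_add_distrib]
    exact Finset.sum_congr rfl fun i _ => by rw [F_apply]; ring
  have hwm : ∑ i, C m i * w i - w m = 1 + b := by
    have h1 : ∀ i, C m i * w i = C m i + C m i * (1 - C i m) := fun i => by
      rcases eq_or_ne i m with rfl | hi
      · simp [hdiag]
      · simp only [hw, if_neg hi]; ring
    simp only [h1, Finset.sum_add_distrib, Matrix.sum_row_of_mem_rowStochastic hCs]
    simp [hw, hb]
  have hwj : ∀ j, j ≠ m → -1 ≤ ∑ i, C j i * w i - w j := fun j hj => by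
    have h1 : ∑ i, C j i * (if i = m then 0 else 1) ≤ ∑ i, C j i * w i := by
      refine Finset.sum_le_sum fun i _ => mul_le_mul_of_nonneg_left ?_ (hCnn j i)
      simp only [hw]
      split_ifs
      · exact le_rfl
      · linarith [hCle i m]
    have h2 : ∑ i, C j i * (if i = m then 0 else 1) = 1 - C j m := by
      have h3 : ∀ i, C j i * (if i = m then (0 : ℝ) else 1) =
          C j i - if i = m then C j i else 0 := fun i => by split_ifs <;> ring
      simp only [h3, Finset.sum_sub_distrib, Matrix.sum_row_of_mem_rowStochastic hCs]
      simp
    have h3 : w j = 2 - C j m := if_neg hj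
    linarith
  have hrest : -(1 - x m) ≤
      ∑ j ∈ Finset.univ.erase m, x j * (1 - x j) * (∑ i, C j i * w i - w j) := by
    rw [← sum_erase_eq hx m, ← Finset.sum_neg_distrib]
    refine Finset.sum_le_sum fun j hj => ?_
    nlinarith [mul_le_mul_of_nonneg_left (hwj j (Finset.ne_of_mem_erase hj))
      (mul_one_sub_nonneg hx j), sq_nonneg (x j)]
  rw [hF, ← Finset.add_sum_erase _ _ (Finset.mem_univ m), hwm]
  nlinarith [mul_nonneg (sub_nonneg.2 hm) (sub_nonneg.2 (le_one_of_mem_stdSimplex hx m))]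

/-- Away from the vertex `m`, one step does not lead close to it. -/
theorem min_le_one_sub_F (hCs : C ∈ Matrix.rowStochastic ℝ (Fin n))
    (hdiag : ∀ i, C i i = 0) (hx : x ∈ stdSimplex ℝ (Fin n)) (m : Fin n) {s : ℝ}
    (hm : s ≤ 1 - x m) : min (s / 2) (1 / (4 * n)) ≤ 1 - F C x m := by
  have h1 : ∑ j, C j m * (x j * (1 - x j)) ≤
      ∑ j ∈ Finset.univ.erase m, x j * (1 - x j) := by
    rw [← Finset.add_sum_erase _ _ (Finset.mem_univ m), hdiag, zero_mul, zero_add]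
    exact Finset.sum_le_sum fun j _ => mul_le_of_le_one_left (mul_one_sub_nonneg hx j)
      (Matrix.le_one_of_mem_rowStochastic hCs)
  have h2 : ∑ j ∈ Finset.univ.erase m, x j * (1 - x j) =
      (1 - x m) - ∑ j ∈ Finset.univ.erase m, x j ^ 2 := by
    rw [← sum_erase_eq hx m, ← Finset.sum_sub_distrib]
    exact Finset.sum_congr rfl fun j _ => by ring
  have h3 : x m * (1 - x m) + ∑ j ∈ Finset.univ.erase m, x j ^ 2 ≤ 1 - F C x m := by
    rw [F_apply]
    linarith
  have h4 : 0 ≤ ∑ j ∈ Finset.univ.erase m, x j ^ 2 :=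
    Finset.sum_nonneg fun j _ => sq_nonneg _
  have h5 := mul_one_sub_nonneg hx m
  have h6 := le_one_of_mem_stdSimplex hx m
  -- In `h3` the term `x m * (1 - x m)` suffices when `x m` is at least one half; otherwise the
  -- remaining mass is at least one half and Cauchy–Schwarz bounds its sum of squares.
  rcases le_total (1 / 2) (x m) with h | h
  · refine (min_le_left _ _).trans ?_
    nlinarith
  · refine (min_le_right _ _).trans ?_
    have hn : (0 : ℝ) < n := Nat.cast_pos.2 m.pos
    have h7 := sq_sum_le_card_mul_sum_sq (s := Finset.univ.erase m) (f := x)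
    rw [sum_erase_eq hx m] at h7
    have h8 : ((Finset.univ.erase m).card : ℝ) ≤ n := by
      exact_mod_cast (Finset.card_le_univ _).trans_eq (Fintype.card_fin n)
    have h9 : 1 / 4 ≤ n * ∑ j ∈ Finset.univ.erase m, x j ^ 2 := by
      nlinarith [mul_le_mul_of_nonneg_right h8 h4]
    have h10 : 1 / (4 * (n : ℝ)) ≤ ∑ j ∈ Finset.univ.erase m, x j ^ 2 := by
      rw [div_le_iff₀ (by positivity)]
      linarith
    linarith

theorem exists_forall_le_one_sub (hCs : C ∈ Matrix.rowStochastic ℝ (Fin n))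
    (hC : C.IsIrreducible) (hdiag : ∀ i, C i i = 0)
    (hstar : ¬ HasStarTopology (digraph C)) {x : ℕ → Fin n → ℝ}
    (hx0 : x 0 ∈ stdSimplex ℝ (Fin n) \ vertices n) (hx : ∀ t, x t ∈ stdSimplex ℝ (Fin n))
    (hF : ∀ t, x (t + 1) = F C (x t)) (m : Fin n) :
    ∃ δ > 0, ∀ t, x t m ≤ 1 - δ := by
  set b := ∑ i, C m i * (1 - C i m) with hb
  have hbpos : 0 < b := sum_mul_one_sub_pos hCs hC hstar m
  have hn : (0 : ℝ) < n := Nat.cast_pos.2 m.pos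
  -- The bound of `min_le_one_sub_F` for `s = b / (1 + b)`, the radius within which the weighted
  -- distance cannot decrease.
  set μ := min (b / (1 + b) / 2) (1 / (4 * n)) with hμ
  have hμpos : 0 < μ := lt_min (by positivity) (by positivity)
  set η := min (vertexDist C m (x 0)) μ with hη
  have hηpos : 0 < η :=
    lt_min ((sub_pos.2 (apply_lt_one hx0 m)).trans_le (le_vertexDist hCs (hx 0) m)) hμpos
  have key : ∀ t, η ≤ vertexDist C m (x t) := by
    intro t
    induction t with
    | zero => exact min_le_left _ _
    | succ t ih =>
      rw [hF]
      rcases le_total (1 - x t m) (b / (1 + b)) with h | h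
      · refine ih.trans (vertexDist_le_vertexDist_F hCs hdiag (hx t) m ?_)
        rw [le_div_iff₀ (by positivity)] at h
        linarith
      · exact ((min_le_right _ _).trans (min_le_one_sub_F hCs hdiag (hx t) m h)).trans
          (le_vertexDist hCs (F_mem_stdSimplex hCs (hx t)) m)
  exact ⟨η / 2, by positivity, fun t => by linarith [key t, vertexDist_le hCs (hx t) m]⟩

/-- A trajectory that does not start at a vertex stays in a compact part of the simplex without
vertices. -/
theorem exists_compact_forall_mem (hCs : C ∈ Matrix.rowStochastic ℝ (Fin n))
    (hC : C.IsIrreducible) (hdiag : ∀ i, C i i = 0)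
    (hstar : ¬ HasStarTopology (digraph C)) {x : ℕ → Fin n → ℝ}
    (hx0 : x 0 ∈ stdSimplex ℝ (Fin n) \ vertices n) (hF : ∀ t, x (t + 1) = F C (x t)) :
    ∃ K ⊆ stdSimplex ℝ (Fin n) \ vertices n, IsCompact K ∧ ∀ t, x t ∈ K := by
  have hx : ∀ t, x t ∈ stdSimplex ℝ (Fin n) := fun t => by
    induction t with
    | zero => exact hx0.1
    | succ t ih => exact hF t ▸ F_mem_stdSimplex hCs ih
  choose δ hδ h using exists_forall_le_one_sub hCs hC hdiag hstar hx0 hx hF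
  refine ⟨stdSimplex ℝ (Fin n) ∩ {y | ∀ m, y m ≤ 1 - δ m}, fun y hy => ⟨hy.1, ?_⟩, ?_,
    fun t => ⟨hx t, fun m => h m t⟩⟩
  · rintro ⟨m, rfl⟩
    have := hy.2 m
    simp only [Pi.single_eq_same] at this
    linarith [hδ m]
  · refine (isCompact_stdSimplex ℝ (Fin n)).inter_right ?_
    simp only [Set.ofPred_forall]
    exact isClosed_iInter fun m => isClosed_le (continuous_apply m) continuous_const

/-! ### Energy argument: an interior fixed point and convergence -/

theorem tendsto_energy_sub (hCs : C ∈ Matrix.rowStochastic ℝ (Fin n))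
    (hC : C.IsIrreducible) (hc : ∀ i, 0 < c i) (hcC : ∀ i, ∑ j, c j * C j i = c i)
    {x : ℕ → Fin n → ℝ} (hx : ∀ t, x t ∈ stdSimplex ℝ (Fin n))
    (hF : ∀ t, x (t + 1) = F C (x t)) :
    Filter.Tendsto (fun t => energy c (x t) - energy c (F C (x t))) Filter.atTop (nhds 0) := by
  have hanti : Antitone fun t => energy c (x t) :=
    antitone_nat_of_succ_le fun t => by
      simpa only [hF] using energy_F_le hCs hC hc hcC (hx t)
  have hbdd : BddBelow (Set.range fun t => energy c (x t)) := by
    obtain ⟨B, hB⟩ := ((isCompact_stdSimplex ℝ (Fin n)).image (continuous_energy c)).bddBelow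
    exact ⟨B, by rintro _ ⟨t, rfl⟩; exact hB ⟨_, hx t, rfl⟩⟩
  have h := tendsto_atTop_ciInf hanti hbdd
  have h' := h.sub ((Filter.tendsto_add_atTop_iff_nat 1).2 h)
  simpa only [hF, sub_self] using h'

/-- A sequence in a compact set along which a continuous nonnegative function tends to zero
is eventually in every neighbourhood of the zero set. -/
theorem eventually_mem_of_tendsto_zero {X : Type*} [TopologicalSpace X] {K U : Set X}
    (hK : IsCompact K) (hU : IsOpen U) {g : X → ℝ} (hg : Continuous g)
    (hpos : ∀ y ∈ K \ U, 0 < g y) {x : ℕ → X} (hx : ∀ t, x t ∈ K)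
    (hlim : Filter.Tendsto (fun t => g (x t)) Filter.atTop (nhds 0)) :
    ∀ᶠ t in Filter.atTop, x t ∈ U := by
  rcases (K \ U).eq_empty_or_nonempty with h | h
  · exact Filter.Eventually.of_forall fun t => Set.sdiff_eq_empty.1 h (hx t)
  · obtain ⟨y, hy, hmin⟩ := (hK.diff hU).exists_isMinOn h hg.continuousOn
    filter_upwards [hlim.eventually (gt_mem_nhds (hpos y hy))] with t ht
    by_contra hU'
    exact absurd (hmin ⟨hx t, hU'⟩) (not_le.2 ht)

theorem continuous_energy_sub (C : Matrix (Fin n) (Fin n) ℝ) (c : Fin n → ℝ) :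
    Continuous fun y => energy c y - energy c (F C y) :=
  (continuous_energy c).sub ((continuous_energy c).comp (continuous_F C))

/-- The trajectory of the uniform vector stays in a compact set off the vertices. Without a fixed
point there, the energy drop would be bounded away from zero along it, contradicting
`tendsto_energy_sub`. -/
theorem exists_fixed_point (hn : 2 ≤ n) (hCs : C ∈ Matrix.rowStochastic ℝ (Fin n))
    (hC : C.IsIrreducible) (hdiag : ∀ i, C i i = 0)
    (hstar : ¬ HasStarTopology (digraph C)) (hc : ∀ i, 0 < c i)
    (hcC : ∀ i, ∑ j, c j * C j i = c i) :
    ∃ z ∈ stdSimplex ℝ (Fin n) \ vertices n, F C z = z := by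
  have hn' : (2 : ℝ) ≤ n := by exact_mod_cast hn
  set x : ℕ → Fin n → ℝ := fun t => (F C)^[t] fun _ => (n : ℝ)⁻¹ with hxdef
  have hF : ∀ t, x (t + 1) = F C (x t) := fun t => Function.iterate_succ_apply' _ _ _
  have hx0 : x 0 ∈ stdSimplex ℝ (Fin n) \ vertices n := by
    refine ⟨⟨fun i => by simp [hxdef], ?_⟩, ?_⟩
    · simp [hxdef, show (n : ℝ) ≠ 0 by positivity]
    · rintro ⟨m, hm⟩
      have := congrFun hm m
      simp only [hxdef, Pi.single_eq_same, Function.iterate_zero, id_eq] at this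
      have h2 := inv_le_one_of_one_le₀ (a := (n : ℝ)) (by linarith)
      have h3 := mul_inv_cancel₀ (show (n : ℝ) ≠ 0 by positivity)
      rw [← this] at h3
      linarith
  obtain ⟨K, hKs, hK, hxK⟩ := exists_compact_forall_mem hCs hC hdiag hstar hx0 hF
  by_contra! hno
  have := eventually_mem_of_tendsto_zero hK isOpen_empty (continuous_energy_sub C c)
    (fun y hy => sub_pos.2 ((energy_F_le hCs hC hc hcC (hKs hy.1).1).lt_of_ne fun h =>
      hno y (hKs hy.1) (F_eq_self_of_energy_eq hCs hC hc hcC (hKs hy.1).1 h)))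
    hxK (tendsto_energy_sub hCs hC hc hcC (fun t => (hKs (hxK t)).1) hF)
  exact this.exists.elim fun _ h => h

/-- A trajectory that does not start at a vertex converges to any fixed point that is the only
one off the vertices. -/
theorem tendsto_of_unique (hCs : C ∈ Matrix.rowStochastic ℝ (Fin n))
    (hC : C.IsIrreducible) (hdiag : ∀ i, C i i = 0)
    (hstar : ¬ HasStarTopology (digraph C)) (hc : ∀ i, 0 < c i)
    (hcC : ∀ i, ∑ j, c j * C j i = c i)
    (hz : ∀ y ∈ stdSimplex ℝ (Fin n) \ vertices n, F C y = y → y = z) {x : ℕ → Fin n → ℝ}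
    (hx0 : x 0 ∈ stdSimplex ℝ (Fin n) \ vertices n) (hF : ∀ t, x (t + 1) = F C (x t)) :
    Filter.Tendsto x Filter.atTop (nhds z) := by
  obtain ⟨K, hKs, hK, hxK⟩ := exists_compact_forall_mem hCs hC hdiag hstar hx0 hF
  rw [tendsto_nhds]
  intro U hU hzU
  refine eventually_mem_of_tendsto_zero hK hU (continuous_energy_sub C c)
    (fun y hy => sub_pos.2 ((energy_F_le hCs hC hc hcC (hKs hy.1).1).lt_of_ne fun h =>
      hy.2 ?_))
    hxK (tendsto_energy_sub hCs hC hc hcC (fun t => (hKs (hxK t)).1) hF)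
  exact hz y (hKs hy.1) (F_eq_self_of_energy_eq hCs hC hc hcC (hKs hy.1).1 h) ▸ hzU

/-! ### Fixed points -/

theorem F_eq_self_iff_inflow : F C x = x ↔
    ∀ i, ∑ j, C j i * (x j * (1 - x j)) = x i * (1 - x i) := by
  rw [funext_iff]
  simp only [F_apply]
  exact forall_congr' fun i => ⟨fun h => by linarith, fun h => by linarith⟩

theorem F_eq_self_of_mem_vertices (hx : x ∈ vertices n) : F C x = x := by
  obtain ⟨m, rfl⟩ := hx
  have h : ∀ j, (Pi.single m 1 : Fin n → ℝ) j * (1 - (Pi.single m 1 : Fin n → ℝ) j) = 0 := by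
    intro j
    rcases eq_or_ne j m with rfl | h <;> simp [*]
  rw [F_eq_self_iff_inflow]
  simp only [h]
  simp

theorem mem_stdSimplex_of_mem_vertices (hx : x ∈ vertices n) : x ∈ stdSimplex ℝ (Fin n) := by
  obtain ⟨m, rfl⟩ := hx
  exact single_mem_stdSimplex ℝ m

theorem exists_pos_eq_mul (hCs : C ∈ Matrix.rowStochastic ℝ (Fin n))
    (hC : C.IsIrreducible) (hc : ∀ i, 0 < c i) (hcC : ∀ i, ∑ j, c j * C j i = c i)
    (hx : x ∈ stdSimplex ℝ (Fin n) \ vertices n) (hF : F C x = x) :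
    ∃ α > 0, ∀ i, x i * (1 - x i) = α * c i := by
  obtain ⟨α, hα⟩ := exists_eq_mul_of_inflow_eq (y := fun i => x i * (1 - x i)) hCs hC hc hcC
    (F_eq_self_iff_inflow.1 hF)
  refine ⟨α, ?_, hα⟩
  obtain ⟨k, hk⟩ : ∃ k, 0 < x k := by
    by_contra! h
    have h1 : ∑ i, x i ≤ 0 := Finset.sum_nonpos fun i _ => h i
    linarith [hx.1.2]
  have h1 := mul_pos hk (sub_pos.2 (apply_lt_one hx k))
  rw [hα k] at h1
  exact pos_of_mul_pos_left h1 (hc k).le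

theorem pos_of_eq_mul (hc : ∀ i, 0 < c i) (hx : x ∈ stdSimplex ℝ (Fin n)) {α : ℝ}
    (hα : 0 < α) (h : ∀ i, x i * (1 - x i) = α * c i) (i : Fin n) : 0 < x i :=
  (hx.1 i).lt_of_ne fun h0 => by
    have := h i
    rw [← h0, zero_mul] at this
    exact absurd this (mul_pos hα (hc i)).ne

theorem exists_ne_ne (hn : 3 ≤ n) (i j : Fin n) : ∃ k, k ≠ i ∧ k ≠ j := by
  by_contra! h
  have h1 : (Finset.univ : Finset (Fin n)) ⊆ {i, j} := fun k _ => by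
    by_cases hk : k = i
    · simp [hk]
    · simp [h k hk]
  have := (Finset.card_le_card h1).trans Finset.card_le_two
  simp at this
  omega

/-- Removing two terms from a sum. -/
theorem sum_eq_add_add_sum_erase_erase (f : Fin n → ℝ) {i j : Fin n} (hij : i ≠ j) :
    ∑ k, f k = f i + f j + ∑ k ∈ (Finset.univ.erase i).erase j, f k := by
  rw [add_assoc, Finset.add_sum_erase _ _ (Finset.mem_erase.2 ⟨hij.symm, Finset.mem_univ j⟩),
    Finset.add_sum_erase _ _ (Finset.mem_univ i)]

theorem add_lt_one (hn : 3 ≤ n) (hx : x ∈ stdSimplex ℝ (Fin n)) (hpos : ∀ i, 0 < x i)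
    {i j : Fin n} (hij : i ≠ j) : x i + x j < 1 := by
  obtain ⟨k, hki, hkj⟩ := exists_ne_ne hn i j
  have h : 0 < ∑ k ∈ (Finset.univ.erase i).erase j, x k :=
    Finset.sum_pos (fun k _ => hpos k) ⟨k, by simp [hki, hkj]⟩
  have := sum_eq_add_add_sum_erase_erase x hij
  rw [hx.2] at this
  linarith

theorem lt_iff_lt_of_eq_mul (hn : 3 ≤ n) (hx : x ∈ stdSimplex ℝ (Fin n))
    (hpos : ∀ i, 0 < x i) {α : ℝ} (hα : 0 < α) (h : ∀ i, x i * (1 - x i) = α * c i)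
    (i j : Fin n) : x i < x j ↔ c i < c j := by
  rcases eq_or_ne i j with rfl | hij
  · simp
  have h1 : α * (c j - c i) = (x j - x i) * (1 - (x i + x j)) := by
    -- The difference of two values of `t * (1 - t)` factors, and the second factor is positive
    -- because a third node carries mass.
    linear_combination h i - h j
  have h2 : 0 < 1 - (x i + x j) := sub_pos.2 (add_lt_one hn hx hpos hij)
  rw [← sub_pos, ← sub_pos (a := c j), ← mul_pos_iff_of_pos_left (b := c j - c i) hα, h1,
    mul_pos_iff_of_pos_right h2]

/-- Compare the nodes `i` and `k` where `z / x` is largest and smallest. Eliminating `α` and `γ`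
gives one equation for these two nodes and the remaining masses `r`, `q`. If the ratios `l` and `u`
differed, it would equate a positive number with zero; `3 ≤ n` makes `r` and `q` positive. -/
theorem eq_of_eq_mul (hn : 3 ≤ n) (hc : ∀ i, 0 < c i) (hx : x ∈ stdSimplex ℝ (Fin n))
    (hz : z ∈ stdSimplex ℝ (Fin n)) {α γ : ℝ} (hα : 0 < α) (hγ : 0 < γ)
    (hxα : ∀ i, x i * (1 - x i) = α * c i) (hzγ : ∀ i, z i * (1 - z i) = γ * c i) :
    x = z := by
  have hxpos := pos_of_eq_mul hc hx hα hxα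
  have hzpos := pos_of_eq_mul hc hz hγ hzγ
  have : Nonempty (Fin n) := ⟨⟨0, by omega⟩⟩
  obtain ⟨i, hi⟩ := Finite.exists_max fun k => z k / x k
  obtain ⟨k, hk⟩ := Finite.exists_min fun k => z k / x k
  set l := z i / x i with hl
  set u := z k / x k with hu
  have hzi : z i = l * x i := (div_mul_cancel₀ _ (hxpos i).ne').symm
  have hzk : z k = u * x k := (div_mul_cancel₀ _ (hxpos k).ne').symm
  have hle : ∀ j, z j ≤ l * x j := fun j => (div_le_iff₀ (hxpos j)).1 (hi j)
  have hge : ∀ j, u * x j ≤ z j := fun j => (le_div_iff₀ (hxpos j)).1 (hk j)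
  have hu0 : 0 < u := div_pos (hzpos k) (hxpos k)
  rcases (hk i).eq_or_lt with hul | hul
  · have h1 : ∀ j, z j = l * x j := fun j => le_antisymm (hle j) (by
      have := hge j
      rwa [hul] at this)
    have h2 : ∑ j, z j = l * ∑ j, x j := by
      rw [Finset.mul_sum]
      exact Finset.sum_congr rfl fun j _ => h1 j
    rw [hx.2, hz.2, mul_one] at h2
    exact funext fun j => by rw [h1 j, ← h2, one_mul]
  · exfalso
    have hik : i ≠ k := fun h => by simp [hu, h] at hul
    have hl0 : 0 < l := hu0.trans hul
    obtain ⟨j, hji, hjk⟩ := exists_ne_ne hn i k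
    set r := ∑ j ∈ (Finset.univ.erase i).erase k, x j with hr
    set q := ∑ j ∈ (Finset.univ.erase i).erase k, z j with hq
    have hr0 : 0 < r := Finset.sum_pos (fun j _ => hxpos j) ⟨j, by simp [hji, hjk]⟩
    have hq0 : 0 < q := Finset.sum_pos (fun j _ => hzpos j) ⟨j, by simp [hji, hjk]⟩
    have hql : q ≤ l * r := by
      rw [hr, Finset.mul_sum]; exact Finset.sum_le_sum fun j _ => hle j
    have huq : u * r ≤ q := by
      rw [hr, Finset.mul_sum]; exact Finset.sum_le_sum fun j _ => hge j
    have hxs := sum_eq_add_add_sum_erase_erase x hik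
    have hzs := sum_eq_add_add_sum_erase_erase z hik
    rw [hx.2] at hxs
    rw [hz.2] at hzs
    have e1 : 1 - x i = x k + r := by linarith
    have e2 : 1 - x k = x i + r := by linarith
    have e3 : 1 - z i = z k + q := by linarith
    have e4 : 1 - z k = z i + q := by linarith
    have hprod : z i * (1 - z i) * (x k * (1 - x k)) = z k * (1 - z k) * (x i * (1 - x i)) := by
      rw [hxα, hxα, hzγ, hzγ]; ring
    rw [e1, e2, e3, e4, hzi, hzk] at hprod
    have hprod' : (x i * x k) *
        (l * (u * x k + q) * (x i + r) - u * (l * x i + q) * (x k + r)) = 0 := by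
      linear_combination hprod
    have h0 := (mul_eq_zero.1 hprod').resolve_left (mul_pos (hxpos i) (hxpos k)).ne'
    have h1 : l * x i * (q - u * r) + u * x k * (l * r - q) + q * r * (l - u) = 0 := by
      linear_combination h0
    have h2 : 0 ≤ l * x i * (q - u * r) :=
      mul_nonneg (mul_pos hl0 (hxpos i)).le (sub_nonneg.2 huq)
    have h3 : 0 ≤ u * x k * (l * r - q) :=
      mul_nonneg (mul_pos hu0 (hxpos k)).le (sub_nonneg.2 hql)
    have h4 : 0 < q * r * (l - u) := mul_pos (mul_pos hq0 hr0) (sub_pos.2 hul)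
    linarith

/-! ### Local exponential convergence -/

/-- A positive definite quadratic function on the hyperplane of vectors with sum zero is bounded
below by a multiple of the squared norm. -/
theorem exists_pos_mul_norm_sq_le {G : (Fin n → ℝ) → ℝ} (hG : Continuous G)
    (hsmul : ∀ (r : ℝ) v, G (r • v) = r ^ 2 * G v)
    (hpos : ∀ v, ∑ i, v i = 0 → v ≠ 0 → 0 < G v) :
    ∃ q > 0, ∀ v, ∑ i, v i = 0 → q * ‖v‖ ^ 2 ≤ G v := by
  set S : Set (Fin n → ℝ) := Metric.sphere 0 1 ∩ {v | ∑ i, v i = 0} with hS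
  have hSc : IsCompact S := (isCompact_sphere _ _).inter_right
    (isClosed_eq (by fun_prop) continuous_const)
  have hunit : ∀ v : Fin n → ℝ, ∑ i, v i = 0 → v ≠ 0 → ‖v‖⁻¹ • v ∈ S := fun v hv h0 => by
    refine ⟨?_, ?_⟩
    · rw [mem_sphere_zero_iff_norm, norm_smul, norm_inv, norm_norm,
        inv_mul_cancel₀ (norm_ne_zero_iff.2 h0)]
    · change ∑ i, ‖v‖⁻¹ * v i = 0
      rw [← Finset.mul_sum, hv, mul_zero]
  obtain ⟨q, hq, hqS⟩ : ∃ q > 0, ∀ v ∈ S, q ≤ G v := by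
    rcases S.eq_empty_or_nonempty with h | h
    · exact ⟨1, one_pos, fun v hv => by simp [h] at hv⟩
    · obtain ⟨w, hw, hmin⟩ := hSc.exists_isMinOn h hG.continuousOn
      refine ⟨G w, hpos w hw.2 fun h0 => ?_, fun v hv => hmin hv⟩
      have := hw.1
      simp [h0] at this
  refine ⟨q, hq, fun v hv => ?_⟩
  rcases eq_or_ne v 0 with rfl | h0
  · have h : G 0 = 0 := by simpa using hsmul 0 0
    simp [h]
  · have h1 := hqS _ (hunit v hv h0)
    have h2 := norm_pos_iff.2 h0
    rw [hsmul, inv_pow, ← div_eq_inv_mul, le_div_iff₀ (by positivity)] at h1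
    exact h1

/-- Only a coordinate `z m ≥ 1 / 2` can spoil the sign, and there is at most one. As `v m` is minus
the sum of the others, Cauchy–Schwarz with weights `z j` bounds its negative term by `k * ∑ v j ^ 2
/ z j`, which the other terms exceed. -/
theorem hessian_pos (hn : 3 ≤ n) (hc : ∀ i, 0 < c i) (hz : z ∈ stdSimplex ℝ (Fin n))
    {α : ℝ} (hα : 0 < α) (hzα : ∀ i, z i * (1 - z i) = α * c i) {v : Fin n → ℝ}
    (hv : ∑ i, v i = 0) (hv0 : v ≠ 0) : 0 < ∑ i, (1 - 2 * z i) / c i * v i ^ 2 := by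
  have hzpos := pos_of_eq_mul hc hz hα hzα
  have hlt : ∀ i, 0 < 1 - z i := fun i =>
    pos_of_mul_pos_right (by rw [hzα]; exact mul_pos hα (hc i)) (hzpos i).le
  by_cases hhalf : ∀ i, z i < 1 / 2
  · obtain ⟨k, hk⟩ := Function.ne_iff.1 hv0
    refine Finset.sum_pos' (fun i _ => ?_) ⟨k, Finset.mem_univ k, ?_⟩
    · exact mul_nonneg (div_nonneg (by linarith [hhalf i]) (hc i).le) (sq_nonneg _)
    · exact mul_pos (div_pos (by linarith [hhalf k]) (hc k)) (sq_pos_of_ne_zero hk)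
  · push Not at hhalf
    obtain ⟨m, hm⟩ := hhalf
    have hcoef : ∀ i, (1 - 2 * z i) / c i = α * ((1 - 2 * z i) / (z i * (1 - z i))) := fun i => by
      rw [hzα]
      have := (hc i).ne'
      have := hα.ne'
      field_simp
    simp only [hcoef, mul_assoc, ← Finset.mul_sum]
    refine mul_pos hα ?_
    set k := (2 * z m - 1) / z m with hk
    have hk0 : 0 ≤ k := div_nonneg (by linarith) (hzpos m).le
    have hvm : v m = -∑ j ∈ Finset.univ.erase m, v j := by
      have := Finset.add_sum_erase Finset.univ v (Finset.mem_univ m)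
      linarith
    have hcs : v m ^ 2 ≤ (1 - z m) * ∑ j ∈ Finset.univ.erase m, v j ^ 2 / z j := by
      rw [hvm, neg_sq, ← sum_erase_eq hz m]
      refine Finset.sum_sq_le_sum_mul_sum_of_sq_le_mul _ (fun j _ => (hzpos j).le)
        (fun j _ => div_nonneg (sq_nonneg _) (hzpos j).le) fun j _ => ?_
      rw [mul_div_cancel₀ _ (hzpos j).ne']
    have hmterm : (1 - 2 * z m) / (z m * (1 - z m)) * v m ^ 2 =
        -(k * (v m ^ 2 / (1 - z m))) := by
      have := (hzpos m).ne'
      have := (hlt m).ne'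
      rw [hk]
      field_simp
      ring
    have hcs' : v m ^ 2 / (1 - z m) ≤ ∑ j ∈ Finset.univ.erase m, v j ^ 2 / z j := by
      rw [div_le_iff₀ (hlt m), mul_comm]
      exact hcs
    -- After clearing denominators this is exactly `z m + z j < 1`.
    have hkj : ∀ j, j ≠ m → k < (1 - 2 * z j) / (1 - z j) := fun j hj => by
      rw [hk, div_lt_div_iff₀ (hzpos m) (hlt j)]
      nlinarith [add_lt_one hn hz hzpos hj]
    have hterm : ∀ j, (1 - 2 * z j) / (z j * (1 - z j)) * v j ^ 2 =
        (1 - 2 * z j) / (1 - z j) * (v j ^ 2 / z j) := fun j => by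
      have := (hzpos j).ne'
      have := (hlt j).ne'
      field_simp
    have hex : ∃ j, j ≠ m ∧ v j ≠ 0 := by
      by_contra! h
      refine hv0 (funext fun j => ?_)
      rcases eq_or_ne j m with rfl | hj
      · rw [hvm, Finset.sum_eq_zero fun i hi => h i (Finset.ne_of_mem_erase hi)]
        simp
      · exact h j hj
    obtain ⟨j₀, hj₀, hvj₀⟩ := hex
    have hlast : ∑ j ∈ Finset.univ.erase m, k * (v j ^ 2 / z j) <
        ∑ j ∈ Finset.univ.erase m, (1 - 2 * z j) / (z j * (1 - z j)) * v j ^ 2 := by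
      refine Finset.sum_lt_sum (fun j hj => ?_) ⟨j₀, by simp [hj₀], ?_⟩
      · rw [hterm]
        exact mul_le_mul_of_nonneg_right (hkj j (Finset.ne_of_mem_erase hj)).le
          (div_nonneg (sq_nonneg _) (hzpos j).le)
      · rw [hterm]
        exact mul_lt_mul_of_pos_right (hkj j₀ hj₀) (div_pos (sq_pos_of_ne_zero hvj₀) (hzpos j₀))
    rw [← Finset.mul_sum] at hlast
    rw [← Finset.add_sum_erase _ _ (Finset.mem_univ m), hmterm]
    linarith [mul_le_mul_of_nonneg_left hcs' hk0]

/-- At `z` the gradient of the energy is the constant `α`, so the first-order term vanishes on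
sum-zero vectors. -/
theorem energy_sub_eq (hc : ∀ i, 0 < c i) {α : ℝ}
    (hzα : ∀ i, z i * (1 - z i) = α * c i) {v : Fin n → ℝ} (hv : ∑ i, v i = 0) :
    energy c (z + v) - energy c z =
      1 / 2 * ∑ i, (1 - 2 * z i) / c i * v i ^ 2 - ∑ i, 1 / (3 * c i) * v i ^ 3 := by
  have h0 : ∑ i, z i * (1 - z i) / c i * v i = 0 := by
    have : ∀ i, z i * (1 - z i) / c i * v i = α * v i := fun i => by
      rw [hzα, mul_div_cancel_right₀ _ (hc i).ne']
    simp only [this, ← Finset.mul_sum, hv, mul_zero]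
  have h1 : energy c (z + v) - energy c z = ∑ i, z i * (1 - z i) / c i * v i +
      (1 / 2 * ∑ i, (1 - 2 * z i) / c i * v i ^ 2 - ∑ i, 1 / (3 * c i) * v i ^ 3) := by
    simp only [energy, Finset.mul_sum, ← Finset.sum_sub_distrib, ← Finset.sum_add_distrib]
    refine Finset.sum_congr rfl fun i _ => ?_
    have := (hc i).ne'
    simp only [Pi.add_apply]
    field_simp
    ring
  rw [h1, h0, zero_add]

/-- The linearization of the displacement `F x - x` at a fixed point. -/
def linDisplacement (C : Matrix (Fin n) (Fin n) ℝ) (z v : Fin n → ℝ) (i : Fin n) : ℝ :=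
  ∑ j, C j i * ((1 - 2 * z j) * v j) - (1 - 2 * z i) * v i

theorem F_sub_eq (hF : F C z = z) (v : Fin n → ℝ) (i : Fin n) :
    F C (z + v) i - (z + v) i =
      linDisplacement C z v i - (∑ j, C j i * v j ^ 2 - v i ^ 2) := by
  have h1 := F_eq_self_iff_inflow.1 hF i
  have h2 : ∑ j, C j i * ((z + v) j * (1 - (z + v) j)) =
      ∑ j, C j i * (z j * (1 - z j)) + ∑ j, C j i * ((1 - 2 * z j) * v j)
        - ∑ j, C j i * v j ^ 2 := by
    rw [← Finset.sum_add_distrib, ← Finset.sum_sub_distrib]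
    refine Finset.sum_congr rfl fun j _ => ?_
    simp only [Pi.add_apply]
    ring
  rw [F_apply, h2, h1, linDisplacement]
  simp only [Pi.add_apply]
  ring

/-- A kernel vector satisfies `(1 - 2 * z i) * v i = τ * c i`; the Hessian form at `v` is then `τ *
∑ v i = 0`, against `hessian_pos`. -/
theorem sum_linDisplacement_sq_pos (hn : 3 ≤ n) (hCs : C ∈ Matrix.rowStochastic ℝ (Fin n))
    (hC : C.IsIrreducible) (hc : ∀ i, 0 < c i) (hcC : ∀ i, ∑ j, c j * C j i = c i)
    (hz : z ∈ stdSimplex ℝ (Fin n)) {α : ℝ} (hα : 0 < α)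
    (hzα : ∀ i, z i * (1 - z i) = α * c i) {v : Fin n → ℝ}
    (hv : ∑ i, v i = 0) (hv0 : v ≠ 0) : 0 < ∑ i, linDisplacement C z v i ^ 2 := by
  refine (Finset.sum_nonneg fun i _ => sq_nonneg _).lt_of_ne fun h0 => ?_
  rw [eq_comm, Finset.sum_eq_zero_iff_of_nonneg fun i _ => sq_nonneg _] at h0
  obtain ⟨τ, hτ⟩ := exists_eq_mul_of_inflow_eq (y := fun i => (1 - 2 * z i) * v i) hCs hC hc hcC
    fun i => sub_eq_zero.1 (pow_eq_zero_iff two_ne_zero |>.1 (h0 i (Finset.mem_univ i)))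
  have h1 : ∀ i, (1 - 2 * z i) / c i * v i ^ 2 = τ * v i := fun i => by
    have h2 := hτ i
    have h3 := (hc i).ne'
    field_simp
    linear_combination v i * h2
  have h2 := hessian_pos hn hc hz hα hzα hv hv0
  simp only [h1, ← Finset.mul_sum, hv, mul_zero, lt_self_iff_false] at h2

theorem abs_apply_le_norm (v : Fin n → ℝ) (i : Fin n) : |v i| ≤ ‖v‖ := by
  simpa using norm_le_pi_norm v i

theorem sum_quadratic_displacement_sq_le (hCs : C ∈ Matrix.rowStochastic ℝ (Fin n))
    (v : Fin n → ℝ) :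
    ∑ i, (∑ j, C j i * v j ^ 2 - v i ^ 2) ^ 2 ≤ n * (n + 1) ^ 2 * ‖v‖ ^ 4 := by
  have hsq : ∀ j, v j ^ 2 ≤ ‖v‖ ^ 2 := fun j => by
    rw [← sq_abs]
    exact pow_le_pow_left₀ (abs_nonneg _) (abs_apply_le_norm v j) 2
  have h1 : ∀ i, |∑ j, C j i * v j ^ 2 - v i ^ 2| ≤ (n + 1) * ‖v‖ ^ 2 := fun i => by
    have h2 : ∑ j, C j i * v j ^ 2 ≤ n * ‖v‖ ^ 2 := by
      have := Finset.sum_le_card_nsmul Finset.univ (fun j => C j i * v j ^ 2) (‖v‖ ^ 2)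
        fun j _ => (mul_le_of_le_one_left (sq_nonneg _)
          (Matrix.le_one_of_mem_rowStochastic hCs)).trans (hsq j)
      simpa using this
    have h3 : 0 ≤ ∑ j, C j i * v j ^ 2 := Finset.sum_nonneg fun j _ =>
      mul_nonneg (Matrix.nonneg_of_mem_rowStochastic hCs) (sq_nonneg _)
    have h4 : 0 ≤ n * ‖v‖ ^ 2 := by positivity
    rw [abs_le]
    constructor <;> linarith [hsq i, sq_nonneg (v i), sq_nonneg ‖v‖]
  have h2 := Finset.sum_le_card_nsmul Finset.univ
    (fun i => (∑ j, C j i * v j ^ 2 - v i ^ 2) ^ 2) (((n + 1) * ‖v‖ ^ 2) ^ 2)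
    fun i _ => by
      rw [← sq_abs]
      exact pow_le_pow_left₀ (abs_nonneg _) (h1 i) 2
  simp only [Finset.card_univ, Fintype.card_fin, nsmul_eq_mul] at h2
  calc _ ≤ _ := h2
    _ = _ := by ring

theorem sum_of_add_mem_stdSimplex (hz : z ∈ stdSimplex ℝ (Fin n)) {v : Fin n → ℝ}
    (hv : z + v ∈ stdSimplex ℝ (Fin n)) : ∑ i, v i = 0 := by
  have := hv.2
  simp only [Pi.add_apply, Finset.sum_add_distrib, hz.2] at this
  linarith

theorem abs_sum_cube_le (hc : ∀ i, 0 < c i) (v : Fin n → ℝ) :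
    |∑ i, 1 / (3 * c i) * v i ^ 3| ≤ (∑ i, 1 / (3 * c i)) * ‖v‖ ^ 3 := by
  rw [Finset.sum_mul]
  refine (Finset.abs_sum_le_sum_abs _ _).trans (Finset.sum_le_sum fun i _ => ?_)
  have h1 : 0 < 1 / (3 * c i) := by have := hc i; positivity
  rw [abs_mul, abs_of_pos h1, abs_pow]
  exact mul_le_mul_of_nonneg_left
    (pow_le_pow_left₀ (abs_nonneg _) (abs_apply_le_norm v i) 3) h1.le

theorem half_hessian_le (hc : ∀ i, 0 < c i) (hz : ∀ i, 0 < z i) (v : Fin n → ℝ) :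
    1 / 2 * ∑ i, (1 - 2 * z i) / c i * v i ^ 2 ≤ (∑ i, 1 / (2 * c i)) * ‖v‖ ^ 2 := by
  rw [Finset.sum_mul, Finset.mul_sum]
  refine Finset.sum_le_sum fun i _ => ?_
  have h1 := hc i
  have h2 : v i ^ 2 ≤ ‖v‖ ^ 2 := by
    rw [← sq_abs]
    exact pow_le_pow_left₀ (abs_nonneg _) (abs_apply_le_norm v i) 2
  have h4 : (1 - 2 * z i) / c i ≤ 1 / c i :=
    div_le_div_of_nonneg_right (by linarith [hz i]) h1.le
  have h5 : 0 ≤ 1 / c i := by positivity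
  calc 1 / 2 * ((1 - 2 * z i) / c i * v i ^ 2) ≤ 1 / 2 * (1 / c i * ‖v‖ ^ 2) := by
        linarith [(mul_le_mul_of_nonneg_right h4 (sq_nonneg (v i))).trans
          (mul_le_mul_of_nonneg_left h2 h5)]
    _ = _ := by field_simp

/-- Near the fixed point the excess energy is comparable to the squared distance. -/
theorem exists_energy_bounds (hn : 3 ≤ n) (hc : ∀ i, 0 < c i)
    (hz : z ∈ stdSimplex ℝ (Fin n)) {α : ℝ} (hα : 0 < α)
    (hzα : ∀ i, z i * (1 - z i) = α * c i) :
    ∃ r > 0, ∃ q > 0, ∃ A > 0, ∀ v, z + v ∈ stdSimplex ℝ (Fin n) → ‖v‖ ≤ r →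
      q * ‖v‖ ^ 2 ≤ energy c (z + v) - energy c z ∧
      energy c (z + v) - energy c z ≤ A * ‖v‖ ^ 2 := by
  have : Nonempty (Fin n) := ⟨⟨0, by omega⟩⟩
  obtain ⟨q, hq, hqv⟩ := exists_pos_mul_norm_sq_le
    (G := fun v => ∑ i, (1 - 2 * z i) / c i * v i ^ 2) (by fun_prop)
    (fun r v => by
      simp only [Pi.smul_apply, smul_eq_mul, Finset.mul_sum]
      exact Finset.sum_congr rfl fun i _ => by ring)
    (fun v hv hv0 => hessian_pos hn hc hz hα hzα hv hv0)
  have hcub := abs_sum_cube_le hc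
  have hquad := half_hessian_le hc (pos_of_eq_mul hc hz hα hzα)
  have hApos : 0 < ∑ i, 1 / (2 * c i) :=
    Finset.sum_pos (fun i _ => by have := hc i; positivity) Finset.univ_nonempty
  have hBpos : 0 < ∑ i, 1 / (3 * c i) :=
    Finset.sum_pos (fun i _ => by have := hc i; positivity) Finset.univ_nonempty
  generalize ∑ i, 1 / (2 * c i) = A at *
  generalize ∑ i, 1 / (3 * c i) = B at *
  -- The radius keeps the cubic term below `q / 4 * ‖v‖ ^ 2`, half of the quadratic lower bound.
  refine ⟨min 1 (q / (4 * B)), lt_min one_pos (by positivity), q / 4, by positivity, A + B,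
    by positivity, fun v hzv hvr => ?_⟩
  have hv := sum_of_add_mem_stdSimplex hz hzv
  have hv1 : ‖v‖ ≤ 1 := hvr.trans (min_le_left _ _)
  have hv2 : ‖v‖ * (4 * B) ≤ q := (le_div_iff₀ (by positivity)).1 (hvr.trans (min_le_right _ _))
  have hcubv := abs_le.1 (hcub v)
  have h1 : B * ‖v‖ ^ 3 ≤ q / 4 * ‖v‖ ^ 2 := by
    calc B * ‖v‖ ^ 3 = ‖v‖ * (4 * B) / 4 * ‖v‖ ^ 2 := by ring
      _ ≤ _ := mul_le_mul_of_nonneg_right (by linarith) (sq_nonneg _)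
  have h2 : B * ‖v‖ ^ 3 ≤ B * ‖v‖ ^ 2 :=
    mul_le_mul_of_nonneg_left (pow_le_pow_of_le_one (norm_nonneg v) hv1 (by norm_num)) hBpos.le
  have h3 := hqv v hv
  have h4 := hquad v
  rw [energy_sub_eq hc hzα hv]
  constructor <;> linarith

/-- Near the fixed point one step decreases the energy at least by a multiple of the squared
distance. -/
theorem exists_energy_decrease (hn : 3 ≤ n) (hCs : C ∈ Matrix.rowStochastic ℝ (Fin n))
    (hC : C.IsIrreducible) (hc : ∀ i, 0 < c i) (hcC : ∀ i, ∑ j, c j * C j i = c i)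
    (hz : z ∈ stdSimplex ℝ (Fin n)) (hF : F C z = z) {α : ℝ} (hα : 0 < α)
    (hzα : ∀ i, z i * (1 - z i) = α * c i) :
    ∃ r > 0, ∃ μ > 0, ∀ v, z + v ∈ stdSimplex ℝ (Fin n) → ‖v‖ ≤ r →
      μ * ‖v‖ ^ 2 ≤ energy c (z + v) - energy c (F C (z + v)) := by
  have hzpos := pos_of_eq_mul hc hz hα hzα
  have : Nonempty (Fin n) := ⟨⟨0, by omega⟩⟩
  obtain ⟨κ, hκ, hκv⟩ := exists_pos_mul_norm_sq_le
    (G := fun v => ∑ i, linDisplacement C z v i ^ 2) (by unfold linDisplacement; fun_prop)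
    (fun r v => by
      have h : ∀ i, linDisplacement C z (r • v) i = r * linDisplacement C z v i := fun i => by
        simp only [linDisplacement, Pi.smul_apply, smul_eq_mul, mul_sub, Finset.mul_sum]
        congr 1
        · exact Finset.sum_congr rfl fun j _ => by ring
        · ring
      simp only [h, mul_pow, ← Finset.mul_sum])
    (fun v hv hv0 => sum_linDisplacement_sq_pos hn hCs hC hc hcC hz hα hzα hv hv0)
  obtain ⟨i₁, hξ⟩ := Finite.exists_min z
  obtain ⟨i₂, hη⟩ := Finite.exists_min fun i => z i / (3 * c i)
  have hηpos : 0 < z i₂ / (3 * c i₂) := div_pos (hzpos _) (by linarith [hc i₂])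
  generalize z i₂ / (3 * c i₂) = η at *
  have hquad := sum_quadratic_displacement_sq_le hCs
  have hMpos : (0 : ℝ) < n * (n + 1) ^ 2 := by
    have : (0 : ℝ) < n := by exact_mod_cast (by omega : 0 < n)
    positivity
  generalize (n : ℝ) * (n + 1) ^ 2 = M at *
  have hz1 := hzpos i₁
  -- The bound `z i₁ / 2` keeps `2 * (z + v) i ≥ z i`, so the dissipation weights stay above `η`;
  -- the other two make the quartic remainder at most `κ / 4 * ‖v‖ ^ 2`.
  refine ⟨min (min 1 (z i₁ / 2)) (κ / (4 * M)),
    lt_min (lt_min one_pos (by positivity)) (by positivity), η * (κ / 4), by positivity,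
    fun v hzv hvr => ?_⟩
  have hv := sum_of_add_mem_stdSimplex hz hzv
  have hv1 : ‖v‖ ≤ 1 := (hvr.trans (min_le_left _ _)).trans (min_le_left _ _)
  have hv2 : ‖v‖ ≤ z i₁ / 2 := (hvr.trans (min_le_left _ _)).trans (min_le_right _ _)
  have hv3 : ‖v‖ * (4 * M) ≤ κ := (le_div_iff₀ (by positivity)).1 (hvr.trans (min_le_right _ _))
  have hF0 := (F_mem_stdSimplex hCs hzv).1
  have hdisp : η * ∑ i, (F C (z + v) i - (z + v) i) ^ 2 ≤
      ∑ i, (2 * (z + v) i + F C (z + v) i) / (3 * c i) * (F C (z + v) i - (z + v) i) ^ 2 := by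
    rw [Finset.mul_sum]
    refine Finset.sum_le_sum fun i _ => mul_le_mul_of_nonneg_right ((hη i).trans ?_) (sq_nonneg _)
    have h1 := hc i
    have h2 := (abs_le.1 (abs_apply_le_norm v i)).1
    have h3 := hF0 i
    have h4 := hξ i
    refine div_le_div_of_nonneg_right ?_ (by positivity)
    rw [Pi.add_apply]
    linarith
  have hsplit : 1 / 2 * ∑ i, linDisplacement C z v i ^ 2 -
      ∑ i, (∑ j, C j i * v j ^ 2 - v i ^ 2) ^ 2 ≤ ∑ i, (F C (z + v) i - (z + v) i) ^ 2 := by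
    rw [Finset.mul_sum, ← Finset.sum_sub_distrib]
    refine Finset.sum_le_sum fun i _ => ?_
    rw [F_sub_eq hF]
    generalize linDisplacement C z v i = a
    generalize ∑ j, C j i * v j ^ 2 - v i ^ 2 = b
    linarith [sq_nonneg (a - 2 * b), (by ring : (a - 2 * b) ^ 2 = a ^ 2 - 4 * a * b + 4 * b ^ 2),
      (by ring : (a - b) ^ 2 = a ^ 2 - 2 * a * b + b ^ 2)]
  have hquart : M * ‖v‖ ^ 4 ≤ κ / 4 * ‖v‖ ^ 2 := by
    have h1 : ‖v‖ ^ 2 ≤ ‖v‖ := by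
      rw [sq]
      exact mul_le_of_le_one_left (norm_nonneg v) hv1
    have h2 : M * ‖v‖ ^ 2 ≤ κ / 4 := by
      linarith [mul_le_mul_of_nonneg_left h1 hMpos.le]
    calc M * ‖v‖ ^ 4 = M * ‖v‖ ^ 2 * ‖v‖ ^ 2 := by ring
      _ ≤ _ := mul_le_mul_of_nonneg_right h2 (sq_nonneg _)
  have hd : κ / 4 * ‖v‖ ^ 2 ≤ ∑ i, (F C (z + v) i - (z + v) i) ^ 2 := by
    linarith [hκv v hv, hquad v]
  rw [mul_assoc]
  exact (mul_le_mul_of_nonneg_left hd hηpos.le).trans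
    (hdisp.trans (sum_le_energy_sub hCs hC hc hcC (z + v)))

theorem exists_local_contraction (hn : 3 ≤ n) (hCs : C ∈ Matrix.rowStochastic ℝ (Fin n))
    (hC : C.IsIrreducible) (hc : ∀ i, 0 < c i) (hcC : ∀ i, ∑ j, c j * C j i = c i)
    (hz : z ∈ stdSimplex ℝ (Fin n)) (hF : F C z = z) {α : ℝ} (hα : 0 < α)
    (hzα : ∀ i, z i * (1 - z i) = α * c i) :
    ∃ r > 0, ∃ q > 0, ∃ θ, 0 < θ ∧ θ < 1 ∧
      ∀ x ∈ stdSimplex ℝ (Fin n), ‖x - z‖ ≤ r →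
        q * ‖x - z‖ ^ 2 ≤ energy c x - energy c z ∧
        energy c (F C x) - energy c z ≤ θ * (energy c x - energy c z) := by
  obtain ⟨r, hr, q, hq, A, hA, hbd⟩ := exists_energy_bounds hn hc hz hα hzα
  obtain ⟨s, hs, μ, hμ, hdec⟩ := exists_energy_decrease hn hCs hC hc hcC hz hF hα hzα
  -- The factor is `1 - μ / A`; the maximum with `1 / 2` only secures positivity.
  refine ⟨min r s, lt_min hr hs, q, hq, max (1 / 2) (1 - μ / A),
    lt_max_of_lt_left (by norm_num), max_lt (by norm_num) (sub_lt_self _ (by positivity)), ?_⟩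
  intro x hx hxr
  obtain ⟨v, rfl⟩ : ∃ v, x = z + v := ⟨x - z, by abel⟩
  rw [add_sub_cancel_left] at hxr ⊢
  obtain ⟨hlow, hup⟩ := hbd v hx (hxr.trans (min_le_left _ _))
  have hd := hdec v hx (hxr.trans (min_le_right _ _))
  refine ⟨hlow, ?_⟩
  have hgain : μ / A * (energy c (z + v) - energy c z) ≤ μ * ‖v‖ ^ 2 := by
    calc _ ≤ μ / A * (A * ‖v‖ ^ 2) := mul_le_mul_of_nonneg_left hup (by positivity)
      _ = _ := by field_simp
  refine le_trans ?_
    (mul_le_mul_of_nonneg_right (le_max_right _ _) (le_trans (by positivity) hlow))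
  linarith

theorem norm_sub_le_one (hx : x ∈ stdSimplex ℝ (Fin n)) (hz : z ∈ stdSimplex ℝ (Fin n)) :
    ‖x - z‖ ≤ 1 := by
  refine (pi_norm_le_iff_of_nonneg zero_le_one).2 fun i => ?_
  rw [Pi.sub_apply, Real.norm_eq_abs, abs_le]
  have h1 := hx.1 i
  have h2 := hz.1 i
  have h3 := le_one_of_mem_stdSimplex hx i
  have h4 := le_one_of_mem_stdSimplex hz i
  constructor <;> linarith

/-- The energy controls the squared distance, hence the rate `√θ`, fixed before the trajectory; only
the entry time `T` into the ball and the energy at that time affect `K`. -/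
theorem exists_rate (hn : 3 ≤ n) (hCs : C ∈ Matrix.rowStochastic ℝ (Fin n))
    (hC : C.IsIrreducible) (hc : ∀ i, 0 < c i) (hcC : ∀ i, ∑ j, c j * C j i = c i)
    (hz : z ∈ stdSimplex ℝ (Fin n)) (hF : F C z = z) {α : ℝ} (hα : 0 < α)
    (hzα : ∀ i, z i * (1 - z i) = α * c i) :
    ∃ ρ : ℝ, 0 < ρ ∧ ρ < 1 ∧ ∀ x : ℕ → Fin n → ℝ, (∀ t, x t ∈ stdSimplex ℝ (Fin n)) →
      (∀ t, x (t + 1) = F C (x t)) → Filter.Tendsto x Filter.atTop (nhds z) →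
      ∃ K : ℝ, 0 < K ∧ ∀ t, ‖x t - z‖ ≤ K * ρ ^ t := by
  obtain ⟨r, hr, q, hq, θ, hθ0, hθ1, hloc⟩ :=
    exists_local_contraction hn hCs hC hc hcC hz hF hα hzα
  have hρ0 := Real.sqrt_pos.2 hθ0
  have hρ1 : √θ < 1 := by rwa [Real.sqrt_lt' one_pos, one_pow]
  refine ⟨√θ, hρ0, hρ1, fun x hx hxF hlim => ?_⟩
  obtain ⟨T, hT⟩ := Metric.tendsto_atTop.1 hlim r hr
  have hball : ∀ k, ‖x (T + k) - z‖ ≤ r := fun k => by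
    rw [← dist_eq_norm]
    exact (hT _ (Nat.le_add_right T k)).le
  set U := energy c (x T) - energy c z with hU
  have hU0 : 0 ≤ U := le_trans (by positivity) (hloc _ (hx T) (hball 0)).1
  have hgeo : ∀ k, energy c (x (T + k)) - energy c z ≤ θ ^ k * U := fun k => by
    induction k with
    | zero => simp [hU]
    | succ k ih =>
      rw [← add_assoc, hxF]
      refine (hloc _ (hx _) (hball k)).2.trans ?_
      calc _ ≤ θ * (θ ^ k * U) := mul_le_mul_of_nonneg_left ih hθ0.le
        _ = _ := by ring
  have htail : ∀ k, ‖x (T + k) - z‖ ≤ √(U / q) * √θ ^ k := fun k => by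
    refine le_of_sq_le_sq ?_ (by positivity)
    rw [mul_pow, Real.sq_sqrt (by positivity), ← pow_mul, mul_comm k, pow_mul,
      Real.sq_sqrt hθ0.le, div_mul_eq_mul_div, le_div_iff₀ hq]
    linarith [(hloc _ (hx _) (hball k)).1.trans (hgeo k)]
  have hρT : 0 < √θ ^ T := pow_pos hρ0 T
  -- The summand `1` covers times before `T`, where the distance is at most `1`; dividing by `√θ ^
  -- T` shifts the time origin.
  refine ⟨(√(U / q) + 1) / √θ ^ T, by positivity, fun t => ?_⟩
  rw [div_mul_eq_mul_div, le_div_iff₀ hρT]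
  rcases le_total T t with h | h
  · obtain ⟨k, rfl⟩ := Nat.exists_eq_add_of_le h
    have h1 : 0 ≤ √θ ^ k := by positivity
    calc _ ≤ (√(U / q) * √θ ^ k) * √θ ^ T := mul_le_mul_of_nonneg_right (htail k) hρT.le
      _ ≤ ((√(U / q) + 1) * √θ ^ k) * √θ ^ T :=
        mul_le_mul_of_nonneg_right (by linarith) hρT.le
      _ = _ := by ring
  · have h1 : √θ ^ T ≤ √θ ^ t := pow_le_pow_of_le_one hρ0.le hρ1.le h
    calc _ ≤ 1 * √θ ^ t :=
        mul_le_mul (norm_sub_le_one (hx t) hz) h1 hρT.le zero_le_one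
      _ ≤ _ := mul_le_mul_of_nonneg_right (by linarith [Real.sqrt_nonneg (U / q)])
        (by positivity)

/-! ### The relative interior of the simplex -/

theorem mem_intrinsicInterior_stdSimplex (hx : x ∈ stdSimplex ℝ (Fin n))
    (hpos : ∀ i, 0 < x i) : x ∈ intrinsicInterior ℝ (stdSimplex ℝ (Fin n)) := by
  have hsum : ∀ y ∈ affineSpan ℝ (stdSimplex ℝ (Fin n)), ∑ i, y i = 1 := by
    intro y hy
    refine affineSpan_induction (p := fun y : Fin n → ℝ => ∑ i, y i = 1) hy (fun y hy => hy.2) ?_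
    intro a u v w hu hv hw
    simp only [vsub_eq_sub, vadd_eq_add, Pi.add_apply, Pi.smul_apply, Pi.sub_apply, smul_eq_mul,
      Finset.sum_add_distrib, ← Finset.mul_sum, Finset.sum_sub_distrib, hu, hv, hw]
    ring
  rw [mem_intrinsicInterior]
  refine ⟨⟨x, subset_affineSpan ℝ _ hx⟩, ?_, rfl⟩
  -- Within the affine span all sums are `1`, so positivity alone defines an open subset of the
  -- simplex.
  refine mem_interior.2 ⟨{y | ∀ i, 0 < (y : Fin n → ℝ) i}, ?_, ?_, hpos⟩
  · exact fun y hy => ⟨fun i => (hy i).le, hsum y y.2⟩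
  · simp only [Set.ofPred_forall]
    exact isOpen_iInter_of_finite fun i =>
      isOpen_lt continuous_const ((continuous_apply i).comp continuous_subtype_val)

end SingleTimescaleDF

theorem theorem2 (n : ℕ) (hn : 3 ≤ n) (C : Matrix (Fin n) (Fin n) ℝ)
    (hC_stoch : C ∈ Matrix.rowStochastic ℝ (Fin n))
    (hC_irred : C.IsIrreducible)
    (hC_diag : ∀ i, C i i = 0)
    (hC_star : ¬ SingleTimescaleDF.HasStarTopology (SingleTimescaleDF.digraph C))
    (c : Fin n → ℝ) (hc : SingleTimescaleDF.IsDominantLeftEigenvector C c) :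
    ∃ xstar : Fin n → ℝ,
      xstar ∈ intrinsicInterior ℝ (stdSimplex ℝ (Fin n)) ∧
      {x | x ∈ stdSimplex ℝ (Fin n) ∧ SingleTimescaleDF.F C x = x} =
        SingleTimescaleDF.vertices n ∪ {xstar} ∧
      (∀ i j, xstar i < xstar j ↔ c i < c j) ∧
      ∃ ρ : ℝ, 0 < ρ ∧ ρ < 1 ∧
        ∀ x : ℕ → Fin n → ℝ, SingleTimescaleDF.IsTrajectory C x →
          x 0 ∈ stdSimplex ℝ (Fin n) \ SingleTimescaleDF.vertices n →
          ∃ K : ℝ, 0 < K ∧ ∀ t, ‖x t - xstar‖ ≤ K * ρ ^ t := by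
  open SingleTimescaleDF in
  have hcC : ∀ i, ∑ j, c j * C j i = c i := fun i => congrFun hc.2 i
  have hcpos := eigenvector_pos hC_irred hc.1 hcC
  obtain ⟨z, hz, hFz⟩ :=
    exists_fixed_point (by omega) hC_stoch hC_irred hC_diag hC_star hcpos hcC
  obtain ⟨α, hα, hzα⟩ := exists_pos_eq_mul hC_stoch hC_irred hcpos hcC hz hFz
  have hzpos := pos_of_eq_mul hcpos hz.1 hα hzα
  have huniq : ∀ y ∈ stdSimplex ℝ (Fin n) \ vertices n, F C y = y → y = z := by
    intro y hy hFy
    obtain ⟨γ, hγ, hyγ⟩ := exists_pos_eq_mul hC_stoch hC_irred hcpos hcC hy hFy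
    exact eq_of_eq_mul hn hcpos hy.1 hz.1 hγ hα hyγ hzα
  refine ⟨z, mem_intrinsicInterior_stdSimplex hz.1 hzpos, ?_,
    lt_iff_lt_of_eq_mul hn hz.1 hzpos hα hzα, ?_⟩
  · ext y
    constructor
    · rintro ⟨hy, hFy⟩
      by_cases hyv : y ∈ vertices n
      · exact Or.inl hyv
      · exact Or.inr (huniq y ⟨hy, hyv⟩ hFy)
    · rintro (hy | rfl)
      · exact ⟨mem_stdSimplex_of_mem_vertices hy, F_eq_self_of_mem_vertices hy⟩
      · exact ⟨hz.1, hFz⟩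
  · obtain ⟨ρ, hρ0, hρ1, hρ⟩ := exists_rate hn hC_stoch hC_irred hcpos hcC hz.1 hFz hα hzα
    refine ⟨ρ, hρ0, hρ1, fun x hx hx0 => ?_⟩
    have hxF : ∀ t, x (t + 1) = F C (x t) := fun t => by rw [hx t, W_transpose_mulVec_eq_F]
    obtain ⟨K, hKs, -, hxK⟩ :=
      exists_compact_forall_mem hC_stoch hC_irred hC_diag hC_star hx0 hxF
    exact hρ x (fun t => (hKs (hxK t)).1) hxF
      (tendsto_of_unique hC_stoch hC_irred hC_diag hC_star hcpos hcC huniq hx0 hxF)
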